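/- Let $K$ be a field of characteristic different from $2$ (for instance a prime field $\mathbb F_p$, $p\neq 2$, or an extension of it), let $a,d\in K^*$ with $a\neq d$, and let $E_{a,d}: ax^2+y^2=1+dx^2y^2$ be the corresponding twisted Edwards curve, with its group law, neutral element $\mathcal O=(0,1)$ and the point $\mathcal O'=(0,-1)$ of order two. The points of $E_{a,d}$ are the points of its smooth projective model, which is the closure of the affine curve in $\mathbb P^1\times\mathbb P^1$. Let $\Omega_1=(1:0:0)$ and $\Omega_2=(0:1:0)$ be the two nodes at infinity of the closure of $E_{a,d}$ in $\mathbb P^2$; in divisors, $2(\Omega_i)$ denotes the sum of the two geometric points of the smooth model lying over $\Omega_i$. For $K$-rational points $P_1,P_2$, let $\phi_{P_1,P_2}$ be an equation $c_{ZZ}Z^2+c_{XY}XY+c_{XZ}XZ+c_{YZ}YZ$ over $K$ (not all coefficients zero) of the conic that passes through $\Omega_1,\Omega_2$ and, counted with multiplicity on the curve, through $P_1$, $P_2$, $-(P_1+P_2)$ and $\mathcal O'$; viewed as the rational function $c_{ZZ}+c_{XY}xy+c_{XZ}x+c_{YZ}y$ on $E_{a,d}$, it has the divisor $$\operatorname{div}(\phi_{P_1,P_2})=(P_1)+(P_2)+(-(P_1+P_2))+(\mathcal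 O')-2(\Omega_1)-2(\Omega_2).$$ Then for every $K$-rational point $R$ of $E_{a,d}$ (in particular, for every point $R$ of a given order $r$) and every choice of these equations, the denominators below are nonzero, and there is a constant $c\in K^*$ such that, in the function field of $E_{a,d}$, $$\frac{\phi_{R,R}}{\phi_{R,-R}^2\cdot\phi_{2R,-2R}}=c\cdot\frac{1}{\phi_{-R,-R}\cdot\phi_{\mathcal O,\mathcal O}}.$$ -/

import Mathlib

/-- A twisted Edwards curve `a x² + y² = 1 + d x² y²` over a field `K` of characteristic
different from `2`, with `a, d ≠ 0` and `a ≠ d`. -/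
structure TwistedEdwards (K : Type*) [Field K] where
  /-- the coefficient `a` -/
  a : K
  /-- the coefficient `d` -/
  d : K
  char_ne_two : (2 : K) ≠ 0
  a_ne_zero : a ≠ 0
  d_ne_zero : d ≠ 0
  a_ne_d : a ≠ d

namespace TwistedEdwards

variable {K : Type*} [Field K]

/-! ### Points

Besides the affine points, the smooth projective model of the curve (its closure in `ℙ¹ × ℙ¹`)
has the points with `x = ∞`, which lie over the node `Ω₁ = (1 : 0 : 0)` of the closure in `ℙ²`,
and the points with `y = ∞`, which lie over the node `Ω₂ = (0 : 1 : 0)`. -/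

/-- The `K`-rational points of (the smooth projective model of) the curve. -/
inductive Point (E : TwistedEdwards K) : Type _
  /-- the affine point `(x, y)` -/
  | affine (x y : K) (h : E.a * x ^ 2 + y ^ 2 = 1 + E.d * x ^ 2 * y ^ 2) : Point E
  /-- the point `(∞, y)`, over the node `Ω₁` -/
  | infX (y : K) (h : E.a = E.d * y ^ 2) : Point E
  /-- the point `(x, ∞)`, over the node `Ω₂` -/
  | infY (x : K) (h : 1 = E.d * x ^ 2) : Point E

namespace Point

variable {E : TwistedEdwards K}

/-- The neutral element `O = (0, 1)`. -/
instance : Zero E.Point := ⟨affine 0 1 (by ring)⟩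

/-- The point `O' = (0, -1)` of order two. -/
def O' (E : TwistedEdwards K) : E.Point := affine 0 (-1) (by ring)

/-- Negation `(x, y) ↦ (-x, y)`. -/
instance : Neg E.Point where
  neg
    | affine x y h => affine (-x) y (by linear_combination h)
    | infX y h => infX y h
    | infY x h => infY (-x) (by linear_combination h)

/-! `(X : Z)` and `(Y : T)` are the homogeneous coordinates of `x` and of `y` in `ℙ¹`. -/

/-- The coordinate `X` of `x = (X : Z)`. -/
def X : E.Point → K
  | affine x _ _ => x
  | infX _ _ => 1
  | infY x _ => x

/-- The coordinate `Z` of `x = (X : Z)`. -/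
def Z : E.Point → K
  | affine _ _ _ => 1
  | infX _ _ => 0
  | infY _ _ => 1

/-- The coordinate `Y` of `y = (Y : T)`. -/
def Y : E.Point → K
  | affine _ y _ => y
  | infX y _ => y
  | infY _ _ => 1

/-- The coordinate `T` of `y = (Y : T)`. -/
def T : E.Point → K
  | affine _ _ _ => 1
  | infX _ _ => 1
  | infY _ _ => 0

theorem equation (P : E.Point) : E.a * P.X ^ 2 * P.T ^ 2 + P.Y ^ 2 * P.Z ^ 2 =
    P.Z ^ 2 * P.T ^ 2 + E.d * P.X ^ 2 * P.Y ^ 2 := by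
  rcases P with ⟨x, y, h⟩ | ⟨y, h⟩ | ⟨x, h⟩ <;> simp only [X, Y, Z, T] <;> linear_combination h

open Classical in
/-- The point with homogeneous coordinates `((X : Z), (Y : T))`. -/
noncomputable def ofCoords (X Z Y T : K)
    (h : E.a * X ^ 2 * T ^ 2 + Y ^ 2 * Z ^ 2 = Z ^ 2 * T ^ 2 + E.d * X ^ 2 * Y ^ 2)
    (hx : X ≠ 0 ∨ Z ≠ 0) (hy : Y ≠ 0 ∨ T ≠ 0) : E.Point :=
  if hZ : Z = 0 then
    infX (Y / T) (by
      have hX : X ≠ 0 := by tauto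
      have h1 : E.a * T ^ 2 = E.d * Y ^ 2 := by
        apply mul_left_cancel₀ (pow_ne_zero 2 hX); subst hZ; linear_combination h
      have hT : T ≠ 0 := by
        rintro rfl
        have := E.d_ne_zero
        simp_all
      field_simp; exact h1)
  else if hT : T = 0 then
    infY (X / Z) (by
      have hY : Y ≠ 0 := by tauto
      have h1 : Z ^ 2 = E.d * X ^ 2 := by
        apply mul_left_cancel₀ (pow_ne_zero 2 hY); subst hT; linear_combination h
      field_simp; exact h1)
  else
    affine (X / Z) (Y / T) (by field_simp; linear_combination h)

theorem law₁ (P Q : E.Point) :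
    E.a * (P.X * Q.Y * Q.Z * P.T + Q.X * P.Y * P.Z * Q.T) ^ 2 *
        (P.Z * Q.Z * P.T * Q.T - E.d * P.X * Q.X * P.Y * Q.Y) ^ 2 +
      (P.Y * Q.Y * P.Z * Q.Z - E.a * P.X * Q.X * P.T * Q.T) ^ 2 *
        (P.Z * Q.Z * P.T * Q.T + E.d * P.X * Q.X * P.Y * Q.Y) ^ 2 =
    (P.Z * Q.Z * P.T * Q.T + E.d * P.X * Q.X * P.Y * Q.Y) ^ 2 *
        (P.Z * Q.Z * P.T * Q.T - E.d * P.X * Q.X * P.Y * Q.Y) ^ 2 +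
      E.d * (P.X * Q.Y * Q.Z * P.T + Q.X * P.Y * P.Z * Q.T) ^ 2 *
        (P.Y * Q.Y * P.Z * Q.Z - E.a * P.X * Q.X * P.T * Q.T) ^ 2 := by
  rcases P with ⟨x, y, h⟩ | ⟨y, h⟩ | ⟨x, h⟩ <;> rcases Q with ⟨x', y', h'⟩ | ⟨y', h'⟩ | ⟨x', h'⟩ <;>
    simp only [X, Y, Z, T] <;> grind

theorem law₂ (P Q : E.Point) :
    E.a * (P.X * P.Y * Q.Z * Q.T + Q.X * Q.Y * P.Z * P.T) ^ 2 *
        (P.X * Q.Y * Q.Z * P.T - Q.X * P.Y * P.Z * Q.T) ^ 2 +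
      (P.X * P.Y * Q.Z * Q.T - Q.X * Q.Y * P.Z * P.T) ^ 2 *
        (E.a * P.X * Q.X * P.T * Q.T + P.Y * Q.Y * P.Z * Q.Z) ^ 2 =
    (E.a * P.X * Q.X * P.T * Q.T + P.Y * Q.Y * P.Z * Q.Z) ^ 2 *
        (P.X * Q.Y * Q.Z * P.T - Q.X * P.Y * P.Z * Q.T) ^ 2 +
      E.d * (P.X * P.Y * Q.Z * Q.T + Q.X * Q.Y * P.Z * P.T) ^ 2 *
        (P.X * P.Y * Q.Z * Q.T - Q.X * Q.Y * P.Z * P.T) ^ 2 := by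
  rcases P with ⟨x, y, h⟩ | ⟨y, h⟩ | ⟨x, h⟩ <;> rcases Q with ⟨x', y', h'⟩ | ⟨y', h'⟩ | ⟨x', h'⟩ <;>
    simp only [X, Y, Z, T] <;> grind

theorem complete (P Q : E.Point)
    (h₁ : ¬ ((P.X * Q.Y * Q.Z * P.T + Q.X * P.Y * P.Z * Q.T ≠ 0 ∨
        P.Z * Q.Z * P.T * Q.T + E.d * P.X * Q.X * P.Y * Q.Y ≠ 0) ∧
      (P.Y * Q.Y * P.Z * Q.Z - E.a * P.X * Q.X * P.T * Q.T ≠ 0 ∨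
        P.Z * Q.Z * P.T * Q.T - E.d * P.X * Q.X * P.Y * Q.Y ≠ 0))) :
    (P.X * P.Y * Q.Z * Q.T + Q.X * Q.Y * P.Z * P.T ≠ 0 ∨
        E.a * P.X * Q.X * P.T * Q.T + P.Y * Q.Y * P.Z * Q.Z ≠ 0) ∧
      (P.X * P.Y * Q.Z * Q.T - Q.X * Q.Y * P.Z * P.T ≠ 0 ∨
        P.X * Q.Y * Q.Z * P.T - Q.X * P.Y * P.Z * Q.T ≠ 0) := by
  have h2 := E.char_ne_two
  have ha := E.a_ne_zero
  have hd := E.d_ne_zero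
  have hn := E.a_ne_d
  rcases P with ⟨x, y, h⟩ | ⟨y, h⟩ | ⟨x, h⟩ <;> rcases Q with ⟨x', y', h'⟩ | ⟨y', h'⟩ | ⟨x', h'⟩ <;>
    simp only [X, Y, Z, T] at h₁ ⊢ <;> grind

open Classical in
/-- The group law, given by a complete pair of bihomogeneous addition laws: the first one is
`(x₁, y₁) + (x₂, y₂) = ((x₁y₂ + x₂y₁) / (1 + d x₁x₂y₁y₂), (y₁y₂ - a x₁x₂) / (1 - d x₁x₂y₁y₂))`,
and the second one, which gives the same sum wherever both are defined, is
`((x₁y₁ + x₂y₂) / (a x₁x₂ + y₁y₂), (x₁y₁ - x₂y₂) / (x₁y₂ - x₂y₁))`. -/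
noncomputable instance : Add E.Point where
  add P Q :=
    if h : (P.X * Q.Y * Q.Z * P.T + Q.X * P.Y * P.Z * Q.T ≠ 0 ∨
          P.Z * Q.Z * P.T * Q.T + E.d * P.X * Q.X * P.Y * Q.Y ≠ 0) ∧
        (P.Y * Q.Y * P.Z * Q.Z - E.a * P.X * Q.X * P.T * Q.T ≠ 0 ∨
          P.Z * Q.Z * P.T * Q.T - E.d * P.X * Q.X * P.Y * Q.Y ≠ 0) then
      ofCoords _ _ _ _ (law₁ P Q) h.1 h.2
    else
      ofCoords _ _ _ _ (law₂ P Q) (complete P Q h).1 (complete P Q h).2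

end Point

/-! ### The function field -/

section

open Polynomial
open scoped Polynomial.Bivariate

/-- The polynomial `α u² + β v² + γ + δ u² v²` in the two variables `u = X` and `v = Y`. -/
noncomputable def biquadratic (α β γ δ : K) : K[X][Y] :=
  C (C β + C δ * X ^ 2) * Y ^ 2 + C (C α * X ^ 2 + C γ)

variable (E : TwistedEdwards K)

/-- The polynomial `a x² + y² - 1 - d x² y²`. -/
noncomputable def polynomial : K[X][Y] := biquadratic E.a 1 (-1) (-E.d)

/-- The affine coordinate ring `K[x, y] / (a x² + y² - 1 - d x² y²)`. -/
abbrev CoordinateRing : Type _ := AdjoinRoot E.polynomial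

theorem irreducible_polynomial : Irreducible E.polynomial := by
  have h2 := E.char_ne_two
  have ha := E.a_ne_zero
  have hd := E.d_ne_zero
  have hn := sub_ne_zero.2 E.a_ne_d
  have hp : E.polynomial = C (C 1 + C (-E.d) * X ^ 2) * X ^ 2 + C 0 * X +
      C (C E.a * X ^ 2 + C (-1)) := by
    simp [polynomial, biquadratic]
  have hlead : (C 1 + C (-E.d) * X ^ 2 : K[X]) ≠ 0 := by
    intro h
    have := congrArg (fun q => coeff q 0) h
    simp at this
  have hdeg : E.polynomial.natDegree = 2 := by
    rw [hp]; exact natDegree_quadratic hlead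
  -- a common divisor of the coefficients is a unit
  have hcop : ∀ g : K[X], g ∣ C 1 + C (-E.d) * X ^ 2 → g ∣ C E.a * X ^ 2 + C (-1) → IsUnit g := by
    intro g h1 h3
    have h4 : g ∣ C (E.a - E.d) := by
      have := dvd_add (Dvd.dvd.mul_left h1 (C E.a)) (Dvd.dvd.mul_left h3 (C E.d))
      convert this using 1
      simp only [map_sub, map_neg, map_one]; ring
    exact isUnit_of_dvd_unit h4 (isUnit_C.2 hn.isUnit)
  have hconst : ∀ f g : K[X][Y], E.polynomial = f * g → f.natDegree = 0 → IsUnit f := by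
    intro f g hfg hf
    rw [eq_C_of_natDegree_eq_zero hf] at hfg ⊢
    refine isUnit_C.2 (hcop _ ?_ ?_)
    · have := congrArg (fun q => coeff q 2) hfg
      rw [hp] at this
      simp only [coeff_add, coeff_C_mul, coeff_X_pow, coeff_X, coeff_C] at this
      exact ⟨_, by simpa [-map_neg] using this⟩
    · have := congrArg (fun q => coeff q 0) hfg
      rw [hp] at this
      simp only [coeff_add, coeff_C_mul, coeff_X_pow, coeff_X, coeff_C] at this
      exact ⟨_, by simpa [-map_neg] using this⟩
  have hne : E.polynomial ≠ 0 := by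
    intro h; rw [h] at hdeg; simp at hdeg
  refine ⟨fun h => ?_, fun f g hfg => ?_⟩
  · have := natDegree_eq_zero_of_isUnit h
    omega
  have hsum : f.natDegree + g.natDegree = 2 := by
    rw [← hdeg, hfg, natDegree_mul (left_ne_zero_of_mul (hfg ▸ hne)) (right_ne_zero_of_mul (hfg ▸ hne))]
  by_cases hf : f.natDegree = 0
  · exact Or.inl (hconst f g hfg hf)
  by_cases hg : g.natDegree = 0
  · exact Or.inr (hconst g f (by rw [hfg, mul_comm]) hg)
  exfalso
  obtain ⟨f1, f0, hf'⟩ := exists_eq_X_add_C_of_natDegree_le_one (show f.natDegree ≤ 1 by omega)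
  obtain ⟨g1, g0, hg'⟩ := exists_eq_X_add_C_of_natDegree_le_one (show g.natDegree ≤ 1 by omega)
  have hfg2 : C (C 1 + C (-E.d) * X ^ 2) * X ^ 2 + C 0 * X + C (C E.a * X ^ 2 + C (-1)) =
      C (f1 * g1) * X ^ 2 + C (f1 * g0 + f0 * g1) * X + C (f0 * g0) := by
    rw [← hp, hfg, hf', hg']; simp only [map_mul, map_add]; ring
  have e2 := congrArg (fun q => coeff q 2) hfg2
  have e1 := congrArg (fun q => coeff q 1) hfg2
  have e0 := congrArg (fun q => coeff q 0) hfg2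
  simp only [coeff_add, coeff_C_mul, coeff_X_pow, coeff_X, coeff_C] at e0 e1 e2
  norm_num at e0 e1 e2
  -- the discriminant would be a square
  have hs : (f1 * g0 - f0 * g1) ^ 2 =
      C (-4 * E.a * -E.d) * X ^ 4 + C (-4 * (E.a + E.d)) * X ^ 2 + C 4 := by
    have : (f1 * g0 - f0 * g1) ^ 2 = -4 * ((f1 * g1) * (f0 * g0)) := by
      linear_combination (-(f1 * g0 + f0 * g1)) * e1
    rw [this, ← e2, ← e0]
    simp only [map_mul, map_neg, map_add, map_ofNat]
    ring
  generalize f1 * g0 - f0 * g1 = s at hs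
  have hsd : s.natDegree ≤ 2 := by
    have h1 : (s ^ 2).natDegree ≤ 4 := by rw [hs]; compute_degree
    rw [natDegree_pow] at h1
    omega
  obtain ⟨p, q, r, rfl⟩ : ∃ p q r : K, s = C p * X ^ 2 + C q * X + C r := by
    refine ⟨s.coeff 2, s.coeff 1, s.coeff 0, ?_⟩
    conv_lhs => rw [s.as_sum_range_C_mul_X_pow' (n := 3) (by omega)]
    simp [Finset.sum_range_succ]; ring
  have hs2 : C (p ^ 2) * X ^ 4 + C (2 * p * q) * X ^ 3 + C (q ^ 2 + 2 * p * r) * X ^ 2 +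
      C (2 * q * r) * X + C (r ^ 2) =
      C (-4 * E.a * -E.d) * X ^ 4 + C (-4 * (E.a + E.d)) * X ^ 2 + C 4 := by
    rw [← hs]; simp only [map_mul, map_add, map_pow, map_ofNat]; ring
  have c0 := congrArg (fun q => coeff q 0) hs2
  have c1 := congrArg (fun q => coeff q 1) hs2
  have c2 := congrArg (fun q => coeff q 2) hs2
  have c4 := congrArg (fun q => coeff q 4) hs2
  simp only [coeff_add, coeff_C_mul, coeff_X_pow, coeff_X, coeff_C] at c0 c1 c2 c4
  norm_num at c0 c1 c2 c4
  have hr : r ≠ 0 := by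
    rintro rfl
    apply h2
    apply pow_eq_zero_iff (two_ne_zero) |>.1
    linear_combination -c0
  have hq : q = 0 := by tauto
  subst hq
  have h4 : (4 : K) ≠ 0 := by
    intro h; apply h2; apply pow_eq_zero_iff (two_ne_zero) |>.1; linear_combination h
  apply hn
  apply pow_eq_zero_iff (two_ne_zero) |>.1
  apply mul_left_cancel₀ (mul_ne_zero h4 h4)
  linear_combination (4 * (E.a + E.d) - 2 * p * r) * c2 + 4 * r ^ 2 * c4 + 16 * E.a * E.d * c0

instance : IsDomain E.CoordinateRing :=
  AdjoinRoot.isDomain_of_prime E.irreducible_polynomial.prime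

/-- The function field of the curve. -/
abbrev FunctionField : Type _ := FractionRing E.CoordinateRing

end

/-! ### Conics -/

/-- A conic `c_ZZ Z² + c_XY XY + c_XZ XZ + c_YZ YZ = 0` in `ℙ²`, that is, a conic passing through
`Ω₁ = (1 : 0 : 0)` and `Ω₂ = (0 : 1 : 0)`: the coefficients of `X²` and `Y²` vanish. -/
structure Conic (K : Type*) [Field K] where
  /-- the coefficient of `Z²` -/
  cZZ : K
  /-- the coefficient of `XY` -/
  cXY : K
  /-- the coefficient of `XZ` -/
  cXZ : K
  /-- the coefficient of `YZ` -/
  cYZ : K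

section

open Polynomial
open scoped Polynomial.Bivariate

variable (E : TwistedEdwards K)

/-- The rational function `c_ZZ + c_XY x y + c_XZ x + c_YZ y` on the curve defined by a conic. -/
noncomputable def Conic.toFunction (φ : Conic K) : E.FunctionField :=
  algebraMap E.CoordinateRing E.FunctionField
    (AdjoinRoot.mk E.polynomial
      (C (C φ.cZZ) + C (C φ.cXY * X) * Y + C (C φ.cXZ * X) + C (C φ.cYZ) * Y))

variable {E}

/-- The equation of the curve in the affine chart `(u, v)` around a point, where
`(u, v) = (x, y)` at an affine point, `(u, v) = (1/x, y)` at a point with `x = ∞`, and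
`(u, v) = (x, 1/y)` at a point with `y = ∞`. -/
noncomputable def Point.chart : E.Point → K[X][Y]
  | .affine _ _ _ => biquadratic E.a 1 (-1) (-E.d)
  | .infX _ _ => biquadratic (-1) (-E.d) E.a 1
  | .infY _ _ => biquadratic (-E.d) (-1) 1 E.a

/-- The coordinate `u` of a point in its chart. -/
def Point.u : E.Point → K
  | .affine x _ _ => x
  | .infX _ _ => 0
  | .infY x _ => x

/-- The coordinate `v` of a point in its chart. -/
def Point.v : E.Point → K
  | .affine _ y _ => y
  | .infX y _ => y
  | .infY _ _ => 0

/-- The ideal `(u - u₀, v - v₀)` of the coordinate ring `K[u, v] / (f)`. -/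
noncomputable def idealAt (f : K[X][Y]) (u₀ v₀ : K) : Ideal (AdjoinRoot f) :=
  Ideal.span {AdjoinRoot.mk f (C (X - C u₀)), AdjoinRoot.mk f (Y - C (C v₀))}

/-- The equation of a conic in the chart around a point of the curve: the function
`φ = c_ZZ + c_XY x y + c_XZ x + c_YZ y` at an affine point, `φ / x` at a point with `x = ∞`, and
`φ / y` at a point with `y = ∞`, expressed in the coordinates `(u, v)` of the chart. -/
noncomputable def Conic.localEquation (φ : Conic K) : E.Point → K[X][Y]
  | .affine _ _ _ => C (C φ.cZZ) + C (C φ.cXY * X) * Y + C (C φ.cXZ * X) + C (C φ.cYZ) * Y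
  | .infX _ _ => C (C φ.cZZ * X) + C (C φ.cXY) * Y + C (C φ.cXZ) + C (C φ.cYZ * X) * Y
  | .infY _ _ => C (C φ.cZZ) * Y + C (C φ.cXY * X) + C (C φ.cXZ * X) * Y + C (C φ.cYZ)

/-- The local equation of the conic `φ` vanishes to order at least `n` at the point `P` of the
curve. (The curve is smooth at `P`, so this says that the local equation lies in the
`n`-th power of the maximal ideal of `P`.)
Since `x` and `y` have simple poles at the points with `x = ∞`, respectively `y = ∞`, and no other
poles, this means that the coefficient at `P` of the divisor `div φ + 2 (Ω₁) + 2 (Ω₂)` is at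
least `n`, where `2 (Ω₁)` and `2 (Ω₂)` are the sums of the two geometric points of the smooth model
over the respective node. -/
def Conic.VanishesToOrder (φ : Conic K) (n : ℕ) (P : E.Point) : Prop :=
  AdjoinRoot.mk P.chart (φ.localEquation P) ∈ idealAt P.chart P.u P.v ^ n

end

open Classical in
/-- `φ` is a conic `φ_{P₁, P₂}`: a (nonzero) conic through `Ω₁`, `Ω₂` and, counted with
multiplicity on the curve, through `P₁`, `P₂`, `-(P₁ + P₂)`, `O'`. Equivalently,
`div φ = (P₁) + (P₂) + (-(P₁ + P₂)) + (O') - 2 (Ω₁) - 2 (Ω₂)`, because the effective divisor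
`div φ + 2 (Ω₁) + 2 (Ω₂)` has degree four. -/
structure IsConicThrough {E : TwistedEdwards K} (φ : Conic K) (P₁ P₂ : E.Point) : Prop where
  ne_zero : ¬ (φ.cZZ = 0 ∧ φ.cXY = 0 ∧ φ.cXZ = 0 ∧ φ.cYZ = 0)
  vanishes : ∀ P : E.Point,
    φ.VanishesToOrder (Multiset.count P {P₁, P₂, -(P₁ + P₂), Point.O' E}) P

end TwistedEdwards

/-!
Both sides have the same divisor, but no theory of divisors is needed, because all the conics can be
written down. Passing through `P₁`, `P₂` and `O'` with multiplicity already determines a conic up to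
a constant. Evaluating at points over `K` and at tangent vectors over the dual numbers turns
vanishing to order one and two into linear equations for the coefficients. Order three would be
needed only for `P₁ = P₂ = O'`, where the fourth point `O` is used instead.
This gives `φ_{Q, -Q} = x (y - y(Q))` up to a constant
(`IsConicThrough.eq_vertical`); in particular `φ_{O, O} = x (y - 1)`. It also gives
`φ_{R, R} = A (1 + y) + x (B y + C)` with `A`, `B`, `C` bihomogeneous in the coordinates of `R`
(`IsConicThrough.eq_tangent`).

Replacing `R` by `-R` changes the sign of `A` only, so up to constants `φ_{R, R} φ_{-R, -R}` is
`x² (B y + C)² - A² (1 + y)²`, the negative of the norm of `A (1 + y) + x (B y + C)` from `K(x, y)`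
to `K(y)`. After cross multiplication and cancellation
of a factor `x`, the claim becomes the identity
`(x² (B y + C)² - A² (1 + y)²) (y - 1) = κ x² (y - y(R))² (y - y(2R))`
on the curve (`Point.exists_norm_tangent`), where a factor with `y(R)` or `y(2R)` infinite is read as
a constant. The addition law enters only through the coordinate
`y(2R)` (`Point.double_Y_T`).
-/

namespace TwistedEdwards

variable {K : Type*} [Field K]

/-! ### Evaluating the vanishing conditions -/

section

open Polynomial
open scoped Polynomial.Bivariate

/-- A function vanishing to order `n` at `(u₀, v₀)` on the curve `f = 0` is sent into `J ^ n` by every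
`S`-valued point `(s, t)` of the curve that reduces to `(u₀, v₀)` modulo the ideal `J`. -/
theorem aevalAeval_mem_pow {S : Type*} [CommRing S] [Algebra K S] {f p : K[X][Y]} {u₀ v₀ : K}
    {n : ℕ} (h : AdjoinRoot.mk f p ∈ idealAt f u₀ v₀ ^ n) {J : Ideal S} {s t : S}
    (hf : aevalAeval s t f = 0) (hs : s - algebraMap K S u₀ ∈ J) (ht : t - algebraMap K S v₀ ∈ J) :
    aevalAeval s t p ∈ J ^ n := by
  let g : AdjoinRoot f →+* S := Ideal.Quotient.lift _ (aevalAeval s t : K[X][Y] →ₐ[K] S).toRingHom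
    (fun q hq => by
      obtain ⟨r, rfl⟩ := Ideal.mem_span_singleton'.1 hq
      change aevalAeval s t (r * f) = 0
      rw [map_mul, hf, mul_zero])
  have hg : ∀ q, g (AdjoinRoot.mk f q) = aevalAeval s t q := fun q => rfl
  have hle : (idealAt f u₀ v₀).map g ≤ J := by
    rw [idealAt, Ideal.map_span, Ideal.span_le]
    rintro _ ⟨z, hz | hz, rfl⟩
    · rw [hz, hg]; simpa [aevalAeval] using hs
    · rw [Set.mem_singleton_iff.1 hz, hg]; simpa [aevalAeval] using ht
  have := Ideal.mem_map_of_mem g h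
  rw [Ideal.map_pow, hg] at this
  exact Ideal.pow_right_mono hle n this

theorem aevalAeval_biquadratic {S : Type*} [CommRing S] [Algebra K S] (α β γ δ : K) (s t : S) :
    aevalAeval s t (biquadratic α β γ δ) = algebraMap K S α * s ^ 2 + algebraMap K S β * t ^ 2 +
      algebraMap K S γ + algebraMap K S δ * s ^ 2 * t ^ 2 := by
  simp [aevalAeval, biquadratic]
  ring

/-- The conditions for a conic to vanish at the point `(u, v)` of the curve
`α u² + β v² + γ + δ u² v² = 0`: its equation vanishes there, and for order at least `2` its gradient
is proportional to half the gradient `(α u + δ u v², β v + δ u² v)` of the curve. -/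
theorem vanishing_conditions {α β γ δ c₀ c₁ c₂ c₃ u v : K} {p : K[X][Y]} {n : ℕ}
    (hp : p = C (C c₀) + C (C c₁ * X) + C (C c₂) * Y + C (C c₃ * X) * Y)
    (hf : α * u ^ 2 + β * v ^ 2 + γ + δ * u ^ 2 * v ^ 2 = 0)
    (h : AdjoinRoot.mk (biquadratic α β γ δ) p ∈ idealAt (biquadratic α β γ δ) u v ^ n) :
    (1 ≤ n → c₀ + c₁ * u + c₂ * v + c₃ * u * v = 0) ∧
    (2 ≤ n → (c₁ + c₃ * v) * (β * v + δ * u ^ 2 * v) = (c₂ + c₃ * u) * (α * u + δ * u * v ^ 2)) := by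
  subst hp
  constructor <;> intro hn
  · have := aevalAeval_mem_pow (Ideal.pow_le_pow_right hn h) (J := (⊥ : Ideal K)) (s := u) (t := v)
      (by rw [aevalAeval_biquadratic]; simpa using hf) (by simp) (by simp)
    simp [aevalAeval] at this
    linear_combination this
  · -- evaluate at the tangent vector, a point of the curve over the dual numbers
    have hε : Ideal.span {(DualNumber.eps : DualNumber K)} ^ 2 = ⊥ := by
      rw [Ideal.span_singleton_pow, pow_two, DualNumber.eps_mul_eps]; simp
    have := aevalAeval_mem_pow (Ideal.pow_le_pow_right hn h)
      (J := Ideal.span {(DualNumber.eps : DualNumber K)})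
      (s := algebraMap K _ u + algebraMap K _ (β * v + δ * u ^ 2 * v) * DualNumber.eps)
      (t := algebraMap K _ v - algebraMap K _ (α * u + δ * u * v ^ 2) * DualNumber.eps)
      (by
        have hf' := congrArg (algebraMap K (DualNumber K)) hf
        have he := DualNumber.eps_mul_eps (R := K)
        rw [aevalAeval_biquadratic]
        simp only [map_add, map_mul, map_pow, map_zero] at hf' ⊢
        grind)
      (by rw [add_sub_cancel_left]; exact Ideal.mul_mem_left _ _ (Ideal.mem_span_singleton_self _))
      (by
        rw [sub_sub_cancel_left, neg_mem_iff]
        exact Ideal.mul_mem_left _ _ (Ideal.mem_span_singleton_self _))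
    rw [hε, Ideal.mem_bot] at this
    have h2 := congrArg TrivSqZeroExt.snd this
    simp [aevalAeval, TrivSqZeroExt.algebraMap_eq_inl] at h2
    linear_combination h2

end

variable {E : TwistedEdwards K}

/-! ### Doubling and the points of the line `x = 0` -/

/-- `ofCoords` changes `(Y : T)` only by a common nonzero factor. -/
theorem Point.ofCoords_Y_T {X Z Y T : K}
    (h : E.a * X ^ 2 * T ^ 2 + Y ^ 2 * Z ^ 2 = Z ^ 2 * T ^ 2 + E.d * X ^ 2 * Y ^ 2)
    (hx : X ≠ 0 ∨ Z ≠ 0) (hy : Y ≠ 0 ∨ T ≠ 0) :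
    ∃ m : K, m ≠ 0 ∧ Y = m * (ofCoords X Z Y T h hx hy).Y ∧ T = m * (ofCoords X Z Y T h hx hy).T := by
  unfold ofCoords
  split_ifs with hZ hT
  · have hT : T ≠ 0 := by
      rintro rfl
      have := E.d_ne_zero
      simp_all
    exact ⟨T, hT, by simp only [Point.Y]; field_simp, by simp [Point.T]⟩
  · have hY : Y ≠ 0 := by tauto
    exact ⟨Y, hY, by simp [Point.Y], by simp [Point.T, hT]⟩
  · exact ⟨T, hT, by simp only [Point.Y]; field_simp, by simp [Point.T]⟩

/-- The `y`-coordinate of `P + P`, given by the first addition law: the second one yields `(0 : 0)`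
when both points are equal, so it is never the one used. -/
theorem Point.double_Y_T (P : E.Point) :
    ∃ m : K, m ≠ 0 ∧ P.Y ^ 2 * P.Z ^ 2 - E.a * P.X ^ 2 * P.T ^ 2 = m * (P + P).Y ∧
      P.Z ^ 2 * P.T ^ 2 - E.d * P.X ^ 2 * P.Y ^ 2 = m * (P + P).T := by
  by_cases h : (P.X * P.Y * P.Z * P.T + P.X * P.Y * P.Z * P.T ≠ 0 ∨
          P.Z * P.Z * P.T * P.T + E.d * P.X * P.X * P.Y * P.Y ≠ 0) ∧
        (P.Y * P.Y * P.Z * P.Z - E.a * P.X * P.X * P.T * P.T ≠ 0 ∨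
          P.Z * P.Z * P.T * P.T - E.d * P.X * P.X * P.Y * P.Y ≠ 0)
  · have hadd : P + P = ofCoords _ _ _ _ (law₁ P P) h.1 h.2 := dif_pos h
    obtain ⟨m, hm, hY, hT⟩ := ofCoords_Y_T (law₁ P P) h.1 h.2
    rw [← hadd] at hY hT
    exact ⟨m, hm, by linear_combination hY, by linear_combination hT⟩
  · exact absurd (complete P P h).2 (by simp)

theorem Point.O'_add_O' : O' E + O' E = 0 := by
  obtain ⟨m, hm, hY, hT⟩ := double_Y_T (O' E)
  have hn := sub_ne_zero.2 E.a_ne_d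
  rcases h : O' E + O' E with ⟨x, y, hxy⟩ | ⟨y, hy⟩ | ⟨x, hx⟩ <;> rw [h] at hY hT <;>
    simp [O', Point.X, Point.Y, Point.Z, Point.T] at hY hT
  · have hy : y = 1 := mul_left_cancel₀ hm (by rw [← hY, ← hT, mul_one])
    subst hy
    have hx : x = 0 := by
      have : (E.a - E.d) * x ^ 2 = 0 := by linear_combination hxy
      simpa [hn] using this
    subst hx
    rfl
  · have hy1 : y = 1 := mul_left_cancel₀ hm (by rw [← hY, ← hT, mul_one])
    subst hy1
    exact absurd (by linear_combination hy) hn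

theorem Point.neg_zero : -(0 : E.Point) = 0 := by
  change Point.affine _ _ _ = Point.affine _ _ _
  simp

theorem Point.neg_O' : -(O' E) = O' E := by
  change Point.affine _ _ _ = Point.affine _ _ _
  simp

theorem Point.affine_eq_zero_or_O' {x y : K} (h) (hx : x = 0) :
    Point.affine (E := E) x y h = 0 ∨ Point.affine (E := E) x y h = O' E := by
  subst hx
  have : (y - 1) * (y + 1) = 0 := by linear_combination h
  rcases mul_eq_zero.1 this with h1 | h1
  · left; obtain rfl : y = 1 := by linear_combination h1
    rfl
  · right; obtain rfl : y = -1 := by linear_combination h1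
    rfl

/-! ### Linear conditions on the coefficients of a conic -/

namespace Conic

variable {φ : Conic K} {n : ℕ}

theorem VanishesToOrder.affine {x y : K} {h} (H : φ.VanishesToOrder n (.affine x y h : E.Point)) :
    (1 ≤ n → φ.cZZ + φ.cXZ * x + φ.cYZ * y + φ.cXY * x * y = 0) ∧
    (2 ≤ n → (φ.cXZ + φ.cXY * y) * (y - E.d * x ^ 2 * y) =
      (φ.cYZ + φ.cXY * x) * (E.a * x - E.d * x * y ^ 2)) := by
  obtain ⟨h₁, h₂⟩ := vanishing_conditions (u := x) (v := y)
    (c₀ := φ.cZZ) (c₁ := φ.cXZ) (c₂ := φ.cYZ) (c₃ := φ.cXY)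
    (by simp only [localEquation]; ring) (by linear_combination h) H
  exact ⟨h₁, fun hn => by linear_combination h₂ hn⟩

theorem VanishesToOrder.infX {y : K} {h} (H : φ.VanishesToOrder n (.infX y h : E.Point)) :
    (1 ≤ n → φ.cXZ + φ.cXY * y = 0) ∧ (2 ≤ n → φ.cZZ + φ.cYZ * y = 0) := by
  obtain ⟨h₁, h₂⟩ := vanishing_conditions (u := 0) (v := y)
    (c₀ := φ.cXZ) (c₁ := φ.cZZ) (c₂ := φ.cXY) (c₃ := φ.cYZ)
    (by simp only [localEquation]; ring) (by linear_combination h) H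
  refine ⟨fun hn => by linear_combination h₁ hn, fun hn => ?_⟩
  have ha := E.a_ne_zero
  have hy : E.d * y ≠ 0 := fun h0 => ha (by linear_combination h + y * h0)
  apply mul_right_cancel₀ hy
  linear_combination -h₂ hn

theorem VanishesToOrder.infY {x : K} {h} (H : φ.VanishesToOrder n (.infY x h : E.Point)) :
    (1 ≤ n → φ.cYZ + φ.cXY * x = 0) ∧ (2 ≤ n → φ.cZZ + φ.cXZ * x = 0) := by
  obtain ⟨h₁, h₂⟩ := vanishing_conditions (u := x) (v := 0)
    (c₀ := φ.cYZ) (c₁ := φ.cXY) (c₂ := φ.cZZ) (c₃ := φ.cXZ)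
    (by simp only [localEquation]; ring) (by linear_combination h) H
  refine ⟨fun hn => by linear_combination h₁ hn, fun hn => ?_⟩
  have hx : E.d * x ≠ 0 := fun h0 => one_ne_zero (α := K) (by linear_combination h + x * h0)
  apply mul_right_cancel₀ hx
  linear_combination h₂ hn

end Conic

/-! ### The conics `φ_{R, R}` and `φ_{Q, -Q}` -/

namespace IsConicThrough

variable {φ : Conic K} {P Q R : E.Point}

theorem one_le (h : IsConicThrough φ P Q) {S : E.Point}
    (hS : S = P ∨ S = Q ∨ S = -(P + Q) ∨ S = Point.O' E) :
    ∃ n, 1 ≤ n ∧ φ.VanishesToOrder n S := by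
  classical
  refine ⟨_, ?_, h.vanishes S⟩
  rw [Nat.one_le_iff_ne_zero, Multiset.count_ne_zero]
  simpa using hS

theorem two_le (h : IsConicThrough φ P P) : ∃ n, 2 ≤ n ∧ φ.VanishesToOrder n P := by
  classical
  refine ⟨_, ?_, h.vanishes P⟩
  simp [Multiset.insert_eq_cons, Multiset.count_cons]

theorem cYZ_eq (h : IsConicThrough φ P Q) : φ.cYZ = φ.cZZ := by
  obtain ⟨n, hn, hv⟩ := h.one_le (S := Point.O' E) (by simp)
  linear_combination - hv.affine.1 hn

/-- The conic `φ_{R, R}` is unique up to a constant; this bihomogeneous formula for its coefficients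
holds at every point, including those at infinity, `O` and `O'`. -/
theorem eq_tangent (h : IsConicThrough φ R R) :
    ∃ k : K, k ≠ 0 ∧ φ.cZZ = k * (R.X * R.Z * (R.T - R.Y)) ∧
      φ.cXY = k * (E.d * R.X ^ 2 * R.Y - R.Z ^ 2 * R.T) ∧
      φ.cXZ = k * (R.Y * R.Z ^ 2 - E.a * R.X ^ 2 * R.T) ∧
      φ.cYZ = k * (R.X * R.Z * (R.T - R.Y)) := by
  have h2 := E.char_ne_two
  have hn := sub_ne_zero.2 E.a_ne_d
  obtain ⟨n, hn', hv⟩ := h.two_le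
  have h0 := h.ne_zero
  have hO := h.cYZ_eq
  suffices ∃ k : K, φ.cZZ = k * (R.X * R.Z * (R.T - R.Y)) ∧
      φ.cXY = k * (E.d * R.X ^ 2 * R.Y - R.Z ^ 2 * R.T) ∧
      φ.cXZ = k * (R.Y * R.Z ^ 2 - E.a * R.X ^ 2 * R.T) by
    obtain ⟨k, h₁, h₂, h₃⟩ := this
    refine ⟨k, ?_, h₁, h₂, h₃, hO.trans h₁⟩
    rintro rfl
    apply h0
    simp_all
  rcases R with ⟨x, y, hR⟩ | ⟨y, hR⟩ | ⟨x, hR⟩ <;> simp only [Point.X, Point.Y, Point.Z, Point.T]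
  · have e1 := hv.affine.1 (by omega)
    have e2 := hv.affine.2 hn'
    by_cases hx : x = 0
    · have hA : φ.cZZ = 0 := by
        rcases Point.affine_eq_zero_or_O' hR hx with hP | hP
        · obtain rfl : y = 1 := by injection hP
          subst hx
          apply mul_left_cancel₀ h2
          linear_combination e1 - hO
        · -- at `R = O'` tangency is not enough, but the conic also passes through `-(O' + O') = O`
          obtain ⟨m, hm, hv'⟩ := h.one_le (S := 0)
            (by rw [hP, Point.O'_add_O', Point.neg_zero]; simp)
          apply mul_left_cancel₀ h2
          linear_combination hv'.affine.1 hm - hO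
      subst hx
      have hy : y ^ 2 = 1 := by linear_combination hR
      refine ⟨-φ.cXY, by simpa using hA, by ring, ?_⟩
      linear_combination y * e2 - (φ.cXZ + φ.cXY * y) * hy
    · have hy : 1 - y ≠ 0 := by
        intro hy
        obtain rfl : y = 1 := by linear_combination -hy
        have : (E.a - E.d) * x ^ 2 = 0 := by linear_combination hR
        simp_all
      have hy' : 1 + y ≠ 0 := by
        intro hy
        obtain rfl : y = -1 := by linear_combination hy
        have : (E.a - E.d) * x ^ 2 = 0 := by linear_combination hR
        simp_all
      -- eliminate `cXZ` between the two conditions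
      have hB : φ.cXY * x * (1 - y) = φ.cZZ * (E.d * x ^ 2 * y - 1) := by
        apply mul_left_cancel₀ hy'
        linear_combination y * (1 - E.d * x ^ 2) * (e1 - y * hO) - x * e2 -
          x ^ 2 * (E.a - E.d * y ^ 2) * hO - (φ.cZZ + φ.cXY * x) * hR
      have hxy : x * (1 - y) ≠ 0 := mul_ne_zero hx hy
      refine ⟨φ.cZZ / (x * (1 - y)), by field_simp, ?_, ?_⟩ <;>
        rw [div_mul_eq_mul_div, eq_div_iff hxy]
      · linear_combination hB
      · linear_combination (1 - y) * (e1 - y * hO) - y * hB + φ.cZZ * hR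
  · have e1 := hv.infX.1 (by omega)
    have e2 := hv.infX.2 hn'
    have hy : 1 + y ≠ 0 := by
      intro hy
      obtain rfl : y = -1 := by linear_combination hy
      exact hn (by linear_combination hR)
    have hA : φ.cZZ = 0 := by
      apply mul_right_cancel₀ hy
      linear_combination e2 - y * hO
    refine ⟨-φ.cXZ / E.a, by simpa using hA, ?_, ?_⟩ <;>
      rw [div_mul_eq_mul_div, eq_div_iff E.a_ne_zero]
    · linear_combination E.d * y * e1 + φ.cXY * hR
    · ring
  · have e1 := hv.infY.1 (by omega)
    have e2 := hv.infY.2 hn'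
    have hx : x ≠ 0 := by rintro rfl; simp at hR
    refine ⟨-φ.cZZ / x, by field_simp; ring, ?_, ?_⟩ <;> rw [div_mul_eq_mul_div, eq_div_iff hx]
    · linear_combination e1 - hO - φ.cZZ * hR
    · linear_combination e2

/-- The conic `φ_{Q, -Q}` is `x (y - y(Q))` up to a constant, read as `x` when `y(Q) = ∞`. -/
theorem eq_vertical (h : IsConicThrough φ Q (-Q)) :
    ∃ k : K, k ≠ 0 ∧ φ.cZZ = 0 ∧ φ.cXY = k * Q.T ∧ φ.cXZ = -(k * Q.Y) ∧ φ.cYZ = 0 := by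
  have h2 := E.char_ne_two
  have hn := sub_ne_zero.2 E.a_ne_d
  have hO := h.cYZ_eq
  have h0 := h.ne_zero
  suffices ∃ k : K, φ.cZZ = 0 ∧ φ.cXY = k * Q.T ∧ φ.cXZ = -(k * Q.Y) by
    obtain ⟨k, h₁, h₂, h₃⟩ := this
    refine ⟨k, ?_, h₁, h₂, h₃, hO.trans h₁⟩
    rintro rfl
    apply h0
    simp_all
  -- if `-Q = Q`, the two conditions merge into the tangency at `Q`
  by_cases hQ : -Q = Q
  · rw [hQ] at h
    obtain ⟨k, hk, e1, e2, e3, e4⟩ := h.eq_tangent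
    rcases Q with ⟨x, y, hR⟩ | ⟨y, hR⟩ | ⟨x, hR⟩ <;>
      simp only [Point.X, Point.Y, Point.Z, Point.T] at e1 e2 e3 ⊢
    · have hx : x = 0 := by
        have : -x = x := by injection hQ
        apply mul_left_cancel₀ h2
        linear_combination -this
      subst hx
      exact ⟨-k, by rw [e1]; ring, by rw [e2]; ring, by rw [e3]; ring⟩
    · exact ⟨k * E.d * y, by rw [e1]; ring, by rw [e2]; ring,
        by rw [e3]; linear_combination -k * hR⟩
    · have hx : x = 0 := by
        have : -x = x := by injection hQ
        apply mul_left_cancel₀ h2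
        linear_combination -this
      simp [hx] at hR
  · obtain ⟨n, hn', hv⟩ := h.one_le (S := Q) (by simp)
    obtain ⟨m, hm', hv'⟩ := h.one_le (S := -Q) (by simp)
    rcases Q with ⟨x, y, hR⟩ | ⟨y, hR⟩ | ⟨x, hR⟩ <;>
      simp only [Point.Y, Point.T]
    · have e1 := hv.affine.1 (by omega)
      have e2 := Conic.VanishesToOrder.affine hv' |>.1 (by omega)
      have hx : x ≠ 0 := by
        intro hx
        apply hQ
        rcases Point.affine_eq_zero_or_O' hR hx with hP | hP
        · rw [hP, Point.neg_zero]
        · rw [hP, Point.neg_O']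
      have hy' : 1 + y ≠ 0 := by
        intro hy
        obtain rfl : y = -1 := by linear_combination hy
        have : (E.a - E.d) * x ^ 2 = 0 := by linear_combination hR
        simp_all
      refine ⟨φ.cXY, ?_, by ring, ?_⟩
      · apply mul_left_cancel₀ (mul_ne_zero h2 hy')
        linear_combination e1 + e2 - 2 * y * hO
      · apply mul_left_cancel₀ (mul_ne_zero h2 hx)
        linear_combination e1 - e2
    · exact absurd rfl hQ
    · have e1 := hv.infY.1 (by omega)
      have e2 := Conic.VanishesToOrder.infY hv' |>.1 (by omega)
      have hx : x ≠ 0 := by rintro rfl; simp at hR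
      refine ⟨-φ.cXZ, ?_, ?_, by ring⟩
      · apply mul_left_cancel₀ h2
        linear_combination e1 + e2 - 2 * hO
      · apply mul_left_cancel₀ (mul_ne_zero h2 hx)
        linear_combination e1 - e2

end IsConicThrough

/-! ### The norm of the tangent conic -/

theorem Point.neg_coords {E : TwistedEdwards K} (P : E.Point) :
    (-P).X * (-P).Z = -(P.X * P.Z) ∧ (-P).X ^ 2 = P.X ^ 2 ∧ (-P).Z = P.Z ∧ (-P).Y = P.Y ∧
      (-P).T = P.T := by
  rcases P with ⟨x, y, h⟩ | ⟨y, h⟩ | ⟨x, h⟩ <;>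
    simp [Point.X, Point.Y, Point.Z, Point.T]

/-- Let `g = A (1 + y) + x (B y + C)` be the tangent conic at `R`, with the coefficients of
`IsConicThrough.eq_tangent`. Up to sign, `g` times its conjugate under `x ↦ -x` is a polynomial in
`x ^ 2` and `y`; multiplied by `y - 1`, it is a constant times
`x ^ 2 (y - y(R)) ^ 2 (y - y(2 R))`. The last two factors are written with
homogeneous coordinates, those of `2 R` being taken from `Point.double_Y_T`. For an affine `R` the
constant `κ` is found by comparing the leading coefficients in `y`. -/
theorem Point.exists_norm_tangent {E : TwistedEdwards K} {A : Type*} [CommRing A] [Algebra K A]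
    {x y : A} (hxy : algebraMap K A E.a * x ^ 2 + y ^ 2 = 1 + algebraMap K A E.d * x ^ 2 * y ^ 2)
    (R : E.Point) :
    ∃ κ : K, κ ≠ 0 ∧
      (x ^ 2 * (algebraMap K A (E.d * R.X ^ 2 * R.Y - R.Z ^ 2 * R.T) * y +
          algebraMap K A (R.Y * R.Z ^ 2 - E.a * R.X ^ 2 * R.T)) ^ 2 -
        algebraMap K A (R.X * R.Z * (R.T - R.Y)) ^ 2 * (1 + y) ^ 2) * (y - 1) =
      algebraMap K A κ * x ^ 2 * (algebraMap K A R.T * y - algebraMap K A R.Y) ^ 2 *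
        (algebraMap K A (R.Z ^ 2 * R.T ^ 2 - E.d * R.X ^ 2 * R.Y ^ 2) * y -
          algebraMap K A (R.Y ^ 2 * R.Z ^ 2 - E.a * R.X ^ 2 * R.T ^ 2)) := by
  have hn := sub_ne_zero.2 E.a_ne_d
  rcases R with ⟨x₀, y₀, h⟩ | ⟨y₀, h⟩ | ⟨x₀, h⟩ <;> simp only [Point.X, Point.Y, Point.Z, Point.T]
  · refine ⟨1 - E.d * x₀ ^ 2, ?_, ?_⟩
    · -- `d x₀² = 1` would force `a x₀² = 1` by the equation of the curve
      intro h0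
      have : (E.a - E.d) * x₀ ^ 2 = 0 := by linear_combination h + (1 - y₀ ^ 2) * h0
      rcases mul_eq_zero.1 this with h' | h'
      · exact hn h'
      · exact one_ne_zero (α := K) (by linear_combination h0 + E.d * h')
    · have h' := congrArg (algebraMap K A) h
      simp only [map_add, map_mul, map_pow, map_sub, map_one] at h' ⊢
      generalize algebraMap K A E.a = a at *
      generalize algebraMap K A E.d = d at *
      generalize algebraMap K A x₀ = x₀ at *
      generalize algebraMap K A y₀ = y₀ at *
      grind
  · refine ⟨-E.d, neg_ne_zero.2 E.d_ne_zero, ?_⟩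
    have h' := congrArg (algebraMap K A) h
    simp only [map_mul, map_pow, map_sub, map_one, map_neg, map_zero] at h' ⊢
    rw [h']
    ring
  · refine ⟨1 - E.a * x₀ ^ 2, ?_, ?_⟩
    · intro h0
      apply hn
      linear_combination E.a * h - E.d * h0
    · have h' := congrArg (algebraMap K A) h
      simp only [map_mul, map_pow, map_sub, map_one, map_zero] at h' ⊢
      generalize algebraMap K A E.a = a at *
      generalize algebraMap K A E.d = d at *
      generalize algebraMap K A x₀ = x₀ at *
      grind

/-! ### Conics as elements of the function field -/

section

open Polynomial
open scoped Polynomial.Bivariate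

/-- A nonzero conic is a nonzero function: its equation has degree at most `1` in `y`, while that
of the curve has degree `2`. -/
theorem toFunction_ne_zero (E : TwistedEdwards K) {φ : Conic K}
    (h : ¬ (φ.cZZ = 0 ∧ φ.cXY = 0 ∧ φ.cXZ = 0 ∧ φ.cYZ = 0)) : φ.toFunction E ≠ 0 := by
  intro h0
  rw [Conic.toFunction, map_eq_zero_iff _ (IsFractionRing.injective _ _),
    AdjoinRoot.mk_eq_zero] at h0
  have hp : C (C φ.cZZ) + C (C φ.cXY * X) * Y + C (C φ.cXZ * X) + C (C φ.cYZ) * Y =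
      C (C φ.cXY * X + C φ.cYZ) * Y + C (C φ.cXZ * X + C φ.cZZ) := by
    simp only [map_add, map_mul]; ring
  have hdeg : E.polynomial.natDegree = 2 := by
    have hlead : (C 1 + C (-E.d) * X ^ 2 : K[X]) ≠ 0 := by
      intro h
      have := congrArg (fun q => coeff q 0) h
      simp at this
    have := natDegree_quadratic (b := 0) (c := C E.a * X ^ 2 + C (-1)) hlead
    rw [← this]
    simp [polynomial, biquadratic]
  rw [hp] at h0
  have hz := eq_zero_of_dvd_of_natDegree_lt h0
    (by rw [hdeg]; exact natDegree_linear_le.trans_lt one_lt_two)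
  have h1 := congrArg (fun q => coeff q 1) hz
  have h2 := congrArg (fun q => coeff q 0) hz
  simp only [coeff_add, coeff_C_mul, coeff_X, coeff_C] at h1 h2
  norm_num at h1 h2
  have e1 := congrArg (fun q => coeff q 1) h1
  have e2 := congrArg (fun q => coeff q 0) h1
  have e3 := congrArg (fun q => coeff q 1) h2
  have e4 := congrArg (fun q => coeff q 0) h2
  simp [coeff_C] at e1 e2 e3 e4
  exact h ⟨e4, e1, e3, e2⟩

/-- The coordinate functions `x` and `y` in the function field. -/
theorem exists_coordinates (E : TwistedEdwards K) : ∃ x y : E.FunctionField,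
    (algebraMap K E.FunctionField E.a * x ^ 2 + y ^ 2 =
      1 + algebraMap K E.FunctionField E.d * x ^ 2 * y ^ 2) ∧
    ∀ φ : Conic K, φ.toFunction E = algebraMap K _ φ.cZZ + algebraMap K _ φ.cXY * x * y +
      algebraMap K _ φ.cXZ * x + algebraMap K _ φ.cYZ * y := by
  have hC : ∀ c : K, algebraMap K E.FunctionField c =
      algebraMap E.CoordinateRing E.FunctionField (AdjoinRoot.mk E.polynomial (C (C c))) :=
    fun c => rfl
  refine ⟨algebraMap _ _ (AdjoinRoot.mk E.polynomial (C X)),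
    algebraMap _ _ (AdjoinRoot.mk E.polynomial Y), ?_, fun φ => ?_⟩
  · have h0 : AdjoinRoot.mk E.polynomial E.polynomial = 0 := AdjoinRoot.mk_self
    have h1 := congrArg (algebraMap E.CoordinateRing E.FunctionField) h0
    conv at h1 => enter [1, 2, 2]; rw [polynomial, biquadratic]
    simp only [hC, ← map_one (algebraMap E.CoordinateRing E.FunctionField),
      ← map_one (AdjoinRoot.mk E.polynomial)]
    simp only [map_add, map_mul, map_pow, map_neg, map_one, map_zero] at h1 ⊢
    linear_combination h1
  · simp only [Conic.toFunction, hC, map_add, map_mul]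

end

end TwistedEdwards

theorem lemma3 {K : Type*} [Field K] (E : TwistedEdwards K) (R : E.Point)
    (φ_R_R φ_R_negR φ_2R_neg2R φ_negR_negR φ_O_O : TwistedEdwards.Conic K)
    (h₁ : TwistedEdwards.IsConicThrough φ_R_R R R)
    (h₂ : TwistedEdwards.IsConicThrough φ_R_negR R (-R))
    (h₃ : TwistedEdwards.IsConicThrough φ_2R_neg2R (R + R) (-(R + R)))
    (h₄ : TwistedEdwards.IsConicThrough φ_negR_negR (-R) (-R))
    (h₅ : TwistedEdwards.IsConicThrough φ_O_O (0 : E.Point) 0) :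
    (φ_R_negR.toFunction E ^ 2 * φ_2R_neg2R.toFunction E ≠ 0 ∧
      φ_negR_negR.toFunction E * φ_O_O.toFunction E ≠ 0) ∧
    ∃ c : K, c ≠ 0 ∧
      φ_R_R.toFunction E / (φ_R_negR.toFunction E ^ 2 * φ_2R_neg2R.toFunction E) =
        algebraMap K E.FunctionField c *
          (1 / (φ_negR_negR.toFunction E * φ_O_O.toFunction E)) := by
  have n₂ := TwistedEdwards.toFunction_ne_zero E h₂.ne_zero
  have n₃ := TwistedEdwards.toFunction_ne_zero E h₃.ne_zero
  have n₄ := TwistedEdwards.toFunction_ne_zero E h₄.ne_zero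
  have n₅ := TwistedEdwards.toFunction_ne_zero E h₅.ne_zero
  have hl : φ_R_negR.toFunction E ^ 2 * φ_2R_neg2R.toFunction E ≠ 0 :=
    mul_ne_zero (pow_ne_zero 2 n₂) n₃
  have hr := mul_ne_zero n₄ n₅
  refine ⟨⟨hl, hr⟩, ?_⟩
  obtain ⟨x, y, hxy, hfun⟩ := E.exists_coordinates
  obtain ⟨k₁, hk₁, e₁, e₁', e₁'', e₁'''⟩ := h₁.eq_tangent
  obtain ⟨k₂, hk₂, e₂, e₂', e₂'', e₂'''⟩ := h₂.eq_vertical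
  obtain ⟨k₃, hk₃, e₃, e₃', e₃'', e₃'''⟩ := h₃.eq_vertical
  obtain ⟨k₄, hk₄, e₄, e₄', e₄'', e₄'''⟩ := h₄.eq_tangent
  -- as `-O = O`, the conic `φ_{O, O}` is also of the form `φ_{Q, -Q}`
  rw [← TwistedEdwards.Point.neg_zero] at h₅
  nth_rewrite 1 [TwistedEdwards.Point.neg_zero] at h₅
  obtain ⟨k₅, hk₅, e₅, e₅', e₅'', e₅'''⟩ := h₅.eq_vertical
  obtain ⟨m, hm, hY, hT⟩ := R.double_Y_T
  obtain ⟨κ, hκ, hid⟩ := R.exists_norm_tangent hxy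
  obtain ⟨i₁, i₂, i₃, i₄, i₅⟩ := R.neg_coords
  have hT0 : (0 : E.Point).T = 1 := rfl
  have hY0 : (0 : E.Point).Y = 1 := rfl
  refine ⟨k₁ * k₄ * k₅ * κ * m / (k₂ ^ 2 * k₃), by simp [*], ?_⟩
  have hc : algebraMap K E.FunctionField (k₁ * k₄ * k₅ * κ * m / (k₂ ^ 2 * k₃)) *
      algebraMap K E.FunctionField (k₂ ^ 2 * k₃) =
        algebraMap K E.FunctionField (k₁ * k₄ * k₅ * κ * m) := by
    rw [← map_mul, div_mul_cancel₀ _ (mul_ne_zero (pow_ne_zero 2 hk₂) hk₃)]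
  generalize algebraMap K E.FunctionField (k₁ * k₄ * k₅ * κ * m / (k₂ ^ 2 * k₃)) = c at hc
  rw [mul_one_div, div_eq_div_iff hl hr]
  rw [hY, hT] at hid
  -- the tangent conic at `-R` is the conjugate of the one at `R` under `x ↦ -x`
  have e₄ : φ_negR_negR.cZZ = k₄ * -(R.X * R.Z * (R.T - R.Y)) := by
    rw [e₄, i₁, i₄, i₅]; ring
  have e₄''' : φ_negR_negR.cYZ = k₄ * -(R.X * R.Z * (R.T - R.Y)) := by
    rw [e₄''', i₁, i₄, i₅]; ring
  rw [i₂, i₃, i₄, i₅] at e₄' e₄''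
  simp only [hfun, e₁, e₁', e₁'', e₁''', e₂, e₂', e₂'', e₂''', e₃, e₃', e₃'', e₃''', e₄, e₄', e₄'',
    e₄''', e₅, e₅', e₅'', e₅''', hT0, hY0]
  generalize R.X * R.Z * (R.T - R.Y) = A at *
  generalize E.d * R.X ^ 2 * R.Y - R.Z ^ 2 * R.T = B at *
  generalize R.Y * R.Z ^ 2 - E.a * R.X ^ 2 * R.T = C at *
  simp only [map_mul, map_neg, map_pow, map_zero, map_one] at hid hc ⊢
  linear_combination (algebraMap K _ k₁ * algebraMap K _ k₄ * algebraMap K _ k₅ * x) * hid -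
    x ^ 3 * (algebraMap K _ R.T * y - algebraMap K _ R.Y) ^ 2 *
      (algebraMap K _ (R + R).T * y - algebraMap K _ (R + R).Y) * hc
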